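/- For a subset $S$ of a metric space $(E,d)$ and a real-valued function $f$ defined at least on $S$, let $$\operatorname{lip}(f,S):=\inf\{L>0 : |f(x)-f(y)|\le L\,d(x,y)\ \text{for all } x,y\in S\}$$ (so that $\operatorname{lip}(f,\emptyset)=0$). **Theorem 1.2.** Let $X$ be a real Hilbert space, not necessarily separable. Let $\Omega$ be an open subset of $X$ and let $u_0:\overline{\Omega}\to\mathbb{R}$ be a Lipschitz function such that $\operatorname{lip}(u_0,\partial\Omega)<\operatorname{lip}(u_0,\overline{\Omega})$. Given $\varepsilon>0$, there exists a function $v:\overline{\Omega}\to\mathbb{R}$ such that $v$ is of class $C^1(\Omega)$ (that is, continuously Fréchet differentiable on $\Omega$), $v$ is Lipschitz on $\overline{\Omega}$ with $\operatorname{lip}(v,\overline{\Omega})\le\operatorname{lip}(u_0,\overline{\Omega})$, $v=u_0$ on $\partial\Omega$, and $|u_0-v|\le\varepsilon$ on $\overline{\Omega}$. -/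

import Mathlib

/-- The Lipschitz constant `lip (f, S)` of a real function on a subset `S` of a metric space:
the infimum of all `L > 0` with `|f x - f y| ≤ L * d(x, y)` for all `x, y ∈ S`.
Only the values of `f` on `S` matter. It is `0` if `S` is empty or a single point. -/
noncomputable def lip {E : Type*} [MetricSpace E] (f : E → ℝ) (S : Set E) : ℝ :=
  sInf {L : ℝ | 0 < L ∧ ∀ x ∈ S, ∀ y ∈ S, |f x - f y| ≤ L * dist x y}

/-- `f` is Lipschitz on `S`. -/
def IsLipschitzOn {E : Type*} [MetricSpace E] (f : E → ℝ) (S : Set E) : Prop :=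
  ∃ L : ℝ, 0 ≤ L ∧ ∀ x ∈ S, ∀ y ∈ S, |f x - f y| ≤ L * dist x y

open Filter Topology
open scoped NNReal

/-! Extend `u₀` from the closure to `u` with constant `K`, and from the frontier to `g` with its
smaller constant `K'`. Lasry-Lions regularization (`LipschitzWith.exists_contDiff_abs_sub_le`) gives
a `C¹` function `U` near `u` at no cost in `K`, but it disturbs boundary values. The gap `K - K'`
pays for making `g` smooth inside `Ω` while fixing it outside
(`LipschitzWith.exists_contDiffOn_eqOn_compl`); call the result `V`. A smoothed median of `V` and `U
± 2a` stays near `U` and equals `V` on the frontier, where `V` and `U` nearly agree. Both gluings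
use `smoothMax`, which preserves Lipschitz constants and is exact away from ties. -/

theorem hasFDerivAt_of_abs_sub_le_sq {E : Type*} [NormedAddCommGroup E] [NormedSpace ℝ E]
    {f : E → ℝ} {L : E →L[ℝ] ℝ} {x : E} {C : ℝ}
    (h : ∀ z, |f z - f x - L (z - x)| ≤ C * ‖z - x‖ ^ 2) : HasFDerivAt f L x := by
  have h0 : HasFDerivAt (fun z => f z - f x - L (z - x)) (0 : E →L[ℝ] ℝ) x := by
    refine Asymptotics.IsBigO.hasFDerivAt (n := 2) ?_ one_lt_two
    refine Asymptotics.IsBigO.of_bound C (Eventually.of_forall fun z => ?_)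
    simpa using h z
  have h1 : HasFDerivAt (fun z => L (z - x) + f x) L x :=
    (L.hasFDerivAt.comp x ((hasFDerivAt_id x).sub_const x)).add_const (f x)
  have h2 := h0.add h1
  rw [zero_add] at h2
  refine h2.congr_of_eventuallyEq (Eventually.of_forall fun z => ?_)
  simp only [Pi.add_apply]
  ring

/-! ### Lasry-Lions regularization in Hilbert space -/

section LasryLions

section Normed

variable {X : Type*} [NormedAddCommGroup X] {K : ℝ≥0} {u : X → ℝ} {c : ℝ}

/-- The upper Moreau envelope `x ↦ sup_y (u y - c ‖x - y‖²)`. -/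
noncomputable def supConv (c : ℝ) (u : X → ℝ) (x : X) : ℝ := ⨆ y, (u y - c * ‖x - y‖ ^ 2)

theorem LipschitzWith.sub_sq_le (hu : LipschitzWith K u) (hc : 0 < c) (x y : X) :
    u y - c * ‖x - y‖ ^ 2 ≤ u x + K ^ 2 / (4 * c) := by
  have h := hu.dist_le_mul y x
  rw [Real.dist_eq, dist_comm, dist_eq_norm] at h
  have h1 := (abs_le.1 h).2
  have h2 : (K : ℝ) * ‖x - y‖ ≤ c * ‖x - y‖ ^ 2 + K ^ 2 / (4 * c) := by
    have : c * ‖x - y‖ ^ 2 + K ^ 2 / (4 * c) - (K : ℝ) * ‖x - y‖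
      = (2 * c * ‖x - y‖ - K) ^ 2 / (4 * c) := by field_simp; ring
    have : 0 ≤ (2 * c * ‖x - y‖ - K) ^ 2 / (4 * c) := by positivity
    linarith
  linarith

theorem bddAbove_supConv (hu : LipschitzWith K u) (hc : 0 < c) (x : X) :
    BddAbove (Set.range fun y => u y - c * ‖x - y‖ ^ 2) :=
  ⟨_, Set.forall_mem_range.2 (hu.sub_sq_le hc x)⟩

theorem le_supConv (hu : LipschitzWith K u) (hc : 0 < c) (x y : X) :
    u y - c * ‖x - y‖ ^ 2 ≤ supConv c u x :=
  le_ciSup (bddAbove_supConv hu hc x) y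

theorem self_le_supConv (hu : LipschitzWith K u) (hc : 0 < c) (x : X) : u x ≤ supConv c u x := by
  simpa using le_supConv hu hc x x

theorem supConv_le (hu : LipschitzWith K u) (hc : 0 < c) (x : X) :
    supConv c u x ≤ u x + K ^ 2 / (4 * c) :=
  ciSup_le (hu.sub_sq_le hc x)

theorem lipschitzWith_supConv (hu : LipschitzWith K u) (hc : 0 < c) :
    LipschitzWith K (supConv c u) := by
  refine LipschitzWith.of_le_add_mul K fun x z => ciSup_le fun y => ?_
  -- Translating the competitor along with the base point leaves the penalty unchanged.
  have h1 := le_supConv hu hc z (y + (z - x))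
  have h2 := hu.dist_le_mul y (y + (z - x))
  rw [Real.dist_eq, dist_self_add_right, ← dist_eq_norm, dist_comm] at h2
  rw [show z - (y + (z - x)) = x - y by abel] at h1
  linarith [(abs_le.1 h2).2]

end Normed

variable {X : Type*} [NormedAddCommGroup X] [InnerProductSpace ℝ X]
  {K : ℝ≥0} {u : X → ℝ} {c : ℝ}

theorem norm_sub_midpoint_sq (x y z : X) :
    ‖x - midpoint ℝ y z‖ ^ 2 = (‖x - y‖ ^ 2 + ‖x - z‖ ^ 2) / 2 - ‖y - z‖ ^ 2 / 4 := by
  have h := parallelogram_law_with_norm ℝ (x - y) (x - z)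
  have h1 : (x - y) + (x - z) = (2 : ℝ) • (x - midpoint ℝ y z) := by
    rw [midpoint_eq_smul_add, smul_sub, smul_smul]
    norm_num [two_smul]
    abel
  rw [h1, norm_smul, sub_sub_sub_cancel_left, norm_sub_rev z y] at h
  norm_num at h
  linarith

/-- `supConv c u` is semiconvex, uniformly in `u`. -/
theorem supConv_midpoint_le (hu : LipschitzWith K u) (hc : 0 < c) (y z : X) :
    supConv c u (midpoint ℝ y z) ≤ (supConv c u y + supConv c u z) / 2 + c / 4 * ‖y - z‖ ^ 2 := by
  refine ciSup_le fun w => ?_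
  have h1 := le_supConv hu hc y w
  have h2 := le_supConv hu hc z w
  rw [norm_sub_rev, norm_sub_midpoint_sq, norm_sub_rev w, norm_sub_rev w]
  linarith

section Semiconcave

variable (hu : LipschitzWith K u) (hc : 0 < c)
  (hsc : ∀ y z, (u y + u z) / 2 - c / 4 * ‖y - z‖ ^ 2 ≤ u (midpoint ℝ y z))
include hu hc hsc

/-- The penalty `2 * c` outweighs the convexity allowed by `hsc`, so the maximand is strongly
concave; testing the midpoint shows that near-maximizers are close together. -/
theorem sq_norm_sub_le_of_semiconcave (x y z : X) :
    c / 4 * ‖y - z‖ ^ 2 ≤ supConv (2 * c) u x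
      - ((u y - 2 * c * ‖x - y‖ ^ 2) + (u z - 2 * c * ‖x - z‖ ^ 2)) / 2 := by
  have h := le_supConv hu (by positivity : 0 < 2 * c) x (midpoint ℝ y z)
  rw [norm_sub_midpoint_sq] at h
  linarith [hsc y z]

theorem exists_supConv_eq_of_semiconcave [CompleteSpace X] (x : X) :
    ∃ p, supConv (2 * c) u x = u p - 2 * c * ‖x - p‖ ^ 2 := by
  have hc' : 0 < 2 * c := by positivity
  have hex : ∀ n : ℕ, ∃ y,
      supConv (2 * c) u x - c / 4 * ((1 / 2) ^ n) ^ 2 < u y - 2 * c * ‖x - y‖ ^ 2 := fun n =>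
    exists_lt_of_lt_ciSup (sub_lt_self _ (by positivity))
  choose y hy using hex
  have hmono : ∀ N n : ℕ, N ≤ n → c / 4 * ((1 / 2 : ℝ) ^ n) ^ 2 ≤ c / 4 * ((1 / 2) ^ N) ^ 2 := by
    intro N n h
    have := pow_le_pow_of_le_one (by norm_num : (0 : ℝ) ≤ 1 / 2) (by norm_num) h
    gcongr
  have hcau : CauchySeq y := by
    refine cauchySeq_of_le_tendsto_0 (fun N => (1 / 2 : ℝ) ^ N) (fun n m N hn hm => ?_)
      (tendsto_pow_atTop_nhds_zero_of_lt_one (by norm_num) (by norm_num))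
    rw [dist_eq_norm]
    refine le_of_sq_le_sq ?_ (by positivity)
    have h := sq_norm_sub_le_of_semiconcave hu hc hsc x (y n) (y m)
    have h1 := hy n
    have h2 := hy m
    have h3 := hmono N n hn
    have h4 := hmono N m hm
    exact le_of_mul_le_mul_left (by linarith) (by positivity : 0 < c / 4)
  obtain ⟨p, hp⟩ := cauchySeq_tendsto_of_complete hcau
  refine ⟨p, le_antisymm ?_ (le_supConv hu hc' x p)⟩
  have hcont : Continuous fun y => u y - 2 * c * ‖x - y‖ ^ 2 := by
    have := hu.continuous
    fun_prop
  have hl : Tendsto (fun n : ℕ => supConv (2 * c) u x - c / 4 * ((1 / 2) ^ n) ^ 2) atTop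
      (𝓝 (supConv (2 * c) u x - c / 4 * 0 ^ 2)) :=
    (((tendsto_pow_atTop_nhds_zero_of_lt_one (by norm_num) (by norm_num)).pow 2).const_mul
      _).const_sub _
  have := le_of_tendsto_of_tendsto hl ((hcont.tendsto p).comp hp)
    (Eventually.of_forall fun n => (hy n).le)
  simpa using this

/-- Summing the strong concavity estimates at `x` and `z` cancels the values of `u` and leaves an
inner product, to which Cauchy-Schwarz applies. -/
theorem norm_sub_le_of_supConv_eq {x z p q : X}
    (hp : supConv (2 * c) u x = u p - 2 * c * ‖x - p‖ ^ 2)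
    (hq : supConv (2 * c) u z = u q - 2 * c * ‖z - q‖ ^ 2) : ‖p - q‖ ≤ 4 * ‖x - z‖ := by
  have h1 := sq_norm_sub_le_of_semiconcave hu hc hsc x p q
  have h2 := sq_norm_sub_le_of_semiconcave hu hc hsc z p q
  have h3 : ‖x - q‖ ^ 2 + ‖z - p‖ ^ 2 - ‖x - p‖ ^ 2 - ‖z - q‖ ^ 2 = 2 * inner ℝ (x - z) (p - q) := by
    simp only [norm_sub_sq_real, inner_sub_left, inner_sub_right]
    ring
  have h4 := real_inner_le_norm (x - z) (p - q)
  have h5 : c * ‖p - q‖ ^ 2 ≤ c * (4 * ‖x - z‖ * ‖p - q‖) := by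
    have : c * inner ℝ (x - z) (p - q) ≤ c * (‖x - z‖ * ‖p - q‖) := by gcongr
    have h6 : c * (‖x - q‖ ^ 2 + ‖z - p‖ ^ 2 - ‖x - p‖ ^ 2 - ‖z - q‖ ^ 2)
      = c * (2 * inner ℝ (x - z) (p - q)) := by rw [h3]
    linarith
  have h6 := le_of_mul_le_mul_left h5 hc
  rcases (norm_nonneg (p - q)).eq_or_lt with h | h
  · rw [← h]; positivity
  · exact le_of_mul_le_mul_right (by linarith) h

theorem contDiff_supConv_of_semiconcave [CompleteSpace X] : ContDiff ℝ 1 (supConv (2 * c) u) := by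
  have hc' : 0 < 2 * c := by positivity
  choose p hp using exists_supConv_eq_of_semiconcave hu hc hsc
  have hpl : ∀ x z, ‖p x - p z‖ ≤ 4 * ‖x - z‖ := fun x z =>
    norm_sub_le_of_supConv_eq hu hc hsc (hp x) (hp z)
  have hpc : Continuous p := (LipschitzWith.of_dist_le_mul (K := 4) fun x z => by
    simpa [dist_eq_norm] using hpl x z).continuous
  -- The maximizer for `x` is a competitor at `z`. Exchanging `x` and `z` gives the upper bound,
  -- since `p` is Lipschitz; the gradient is `4c (p x - x)`.
  have hlow : ∀ x z, supConv (2 * c) u x + 4 * c * inner ℝ (p x - x) (z - x)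
      - 2 * c * ‖z - x‖ ^ 2 ≤ supConv (2 * c) u z := by
    intro x z
    refine le_trans (le_of_eq ?_) (le_supConv hu hc' z (p x))
    rw [hp x, show z - p x = (z - x) - (p x - x) by abel, norm_sub_sq_real (z - x),
      norm_sub_rev x (p x), real_inner_comm (p x - x)]
    ring
  refine contDiff_one_iff_hasFDerivAt.2
    ⟨fun x => innerSL ℝ ((4 * c) • (p x - x)), by fun_prop, fun x => ?_⟩
  refine hasFDerivAt_of_abs_sub_le_sq (C := 22 * c) fun z => ?_
  have h1 := hlow x z
  have h2 := hlow z x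
  have h3 : inner ℝ (p z - z) (x - z) + inner ℝ (p x - x) (z - x)
      = inner ℝ (p x - p z) (z - x) + ‖z - x‖ ^ 2 := by
    rw [← real_inner_self_eq_norm_sq]
    simp only [inner_sub_left, inner_sub_right]
    ring
  have h4 : -(4 * ‖z - x‖ ^ 2) ≤ inner ℝ (p x - p z) (z - x) := by
    have h5 := abs_real_inner_le_norm (p x - p z) (z - x)
    have h6 : ‖p x - p z‖ * ‖z - x‖ ≤ 4 * ‖z - x‖ * ‖z - x‖ := by
      gcongr
      rw [norm_sub_rev z x]
      exact hpl x z
    nlinarith [(abs_le.1 h5).1]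
  have h5 : (0 : ℝ) ≤ c * ‖z - x‖ ^ 2 := by positivity
  have h7 : c * (inner ℝ (p z - z) (x - z) + inner ℝ (p x - x) (z - x)) ≥
      c * (-(4 * ‖z - x‖ ^ 2) + ‖z - x‖ ^ 2) := by
    rw [h3]; gcongr
  rw [norm_sub_rev x z] at h2
  simp only [innerSL_apply_apply, inner_smul_left, RCLike.conj_to_real]
  rw [abs_le]
  constructor <;> linarith

end Semiconcave

/-- Lasry-Lions regularization: Lipschitz functions on a Hilbert space are uniform limits of `C¹`
functions with the same Lipschitz constant. -/
theorem LipschitzWith.exists_contDiff_abs_sub_le [CompleteSpace X] (hu : LipschitzWith K u)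
    {δ : ℝ} (hδ : 0 < δ) :
    ∃ w : X → ℝ, ContDiff ℝ 1 w ∧ LipschitzWith K w ∧ ∀ x, |w x - u x| ≤ δ := by
  obtain ⟨c, hc, hcK⟩ : ∃ c : ℝ, 0 < c ∧ (K : ℝ) ^ 2 / (4 * c) ≤ δ := by
    -- The `+ 1` keeps `c` positive when `K = 0`.
    refine ⟨(K ^ 2 + 1) / (4 * δ), by positivity, ?_⟩
    rw [show (4 : ℝ) * ((K ^ 2 + 1) / (4 * δ)) = (K ^ 2 + 1) / δ by field_simp,
      div_div_eq_mul_div, div_le_iff₀ (by positivity)]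
    nlinarith
  have hn : LipschitzWith K (-u) := hu.neg
  have hφ : LipschitzWith K (-supConv c (-u)) := (lipschitzWith_supConv hn hc).neg
  have hc' : 0 < 2 * c := by positivity
  refine ⟨supConv (2 * c) (-supConv c (-u)), contDiff_supConv_of_semiconcave hφ hc fun y z => ?_,
    lipschitzWith_supConv hφ hc', fun x => ?_⟩
  · have := supConv_midpoint_le hn hc y z
    simp only [Pi.neg_apply]
    linarith
  · have h1 := self_le_supConv hn hc x
    have h2 := supConv_le hn hc x
    have h3 := self_le_supConv hφ hc' x
    have h4 := supConv_le hφ hc' x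
    have h5 : (K : ℝ) ^ 2 / (4 * (2 * c)) ≤ K ^ 2 / (4 * c) := by gcongr; linarith
    simp only [Pi.neg_apply] at h1 h2 h3 h4
    rw [abs_le]
    constructor <;> linarith

end LasryLions

/-! ### A `C¹` maximum preserving Lipschitz constants -/

theorem hasDerivAt_max_zero_sq (s : ℝ) :
    HasDerivAt (fun t : ℝ => max t 0 ^ 2) (2 * max s 0) s := by
  rw [hasDerivAt_iff_hasFDerivAt]
  refine hasFDerivAt_of_abs_sub_le_sq (C := 1) fun z => ?_
  simp only [ContinuousLinearMap.toSpanSingleton_apply, smul_eq_mul, Real.norm_eq_abs, sq_abs,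
    one_mul]
  rw [abs_le]
  rcases le_total z 0 with hz | hz <;> rcases le_total s 0 with hs | hs <;>
    simp only [max_eq_left, max_eq_right, hz, hs] <;> constructor <;> nlinarith

/-- A `C¹` regularization of `s ↦ max s 0`, equal to it where `a ≤ |s|`. -/
noncomputable def ramp (a s : ℝ) : ℝ := (max (s + a) 0 ^ 2 - max (s - a) 0 ^ 2) / (4 * a)

theorem hasDerivAt_ramp (a s : ℝ) :
    HasDerivAt (ramp a) ((2 * max (s + a) 0 - 2 * max (s - a) 0) / (4 * a)) s := by
  have h1 := (hasDerivAt_max_zero_sq (s + a)).comp_add_const s a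
  have h2 := (hasDerivAt_max_zero_sq (s - a)).comp_sub_const s a
  exact (h1.sub h2).div_const (4 * a)

theorem contDiff_ramp (a : ℝ) : ContDiff ℝ 1 (ramp a) := by
  rw [contDiff_one_iff_deriv]
  refine ⟨fun s => (hasDerivAt_ramp a s).differentiableAt, ?_⟩
  rw [show deriv (ramp a) = _ from funext fun s => (hasDerivAt_ramp a s).deriv]
  fun_prop

section Ramp

variable {a : ℝ} (ha : 0 < a)
include ha

theorem monotone_ramp : Monotone (ramp a) := by
  refine monotone_of_hasDerivAt_nonneg (hasDerivAt_ramp a) fun s => ?_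
  have : max (s - a) 0 ≤ max (s + a) 0 := max_le_max_right _ (by linarith)
  exact div_nonneg (by linarith) (by linarith)

theorem monotone_sub_ramp : Monotone fun s => s - ramp a s := by
  refine monotone_of_hasDerivAt_nonneg (fun s => (hasDerivAt_id s).sub (hasDerivAt_ramp a s))
    fun s => ?_
  have : max (s + a) 0 ≤ max (s - a) 0 + 2 * a := by
    refine max_le ?_ ?_
    · linarith [le_max_left (s - a) 0]
    · linarith [le_max_right (s - a) 0]
  simp only [Pi.zero_apply, sub_nonneg]
  rw [div_le_one (by positivity)]
  linarith

theorem ramp_of_le {s : ℝ} (h : s ≤ -a) : ramp a s = 0 := by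
  rw [ramp, max_eq_right (by linarith), max_eq_right (by linarith)]
  simp

theorem ramp_of_ge {s : ℝ} (h : a ≤ s) : ramp a s = s := by
  rw [ramp, max_eq_left (by linarith), max_eq_left (by linarith)]
  field_simp
  ring

theorem ramp_nonneg (s : ℝ) : 0 ≤ ramp a s := by
  rw [← ramp_of_le ha (min_le_right s (-a))]
  exact monotone_ramp ha (min_le_left _ _)

theorem ramp_le (s : ℝ) : ramp a s ≤ max s 0 + a := by
  refine (monotone_ramp ha (?_ : s ≤ max s 0 + a)).trans (ramp_of_ge ha ?_).le
  · linarith [le_max_left s 0]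
  · linarith [le_max_right s 0]

end Ramp

/-- A `C¹` regularization of `max p q`, equal to it where `a ≤ |p - q|`. -/
noncomputable def smoothMax (a p q : ℝ) : ℝ := q + ramp a (p - q)

section SmoothMax

variable {a : ℝ} (ha : 0 < a)
include ha

theorem smoothMax_of_add_le {p q : ℝ} (h : q + a ≤ p) : smoothMax a p q = p := by
  rw [smoothMax, ramp_of_ge ha (by linarith)]
  ring

theorem right_le_smoothMax (p q : ℝ) : q ≤ smoothMax a p q := by
  linarith [ramp_nonneg ha (p - q), show smoothMax a p q = q + ramp a (p - q) from rfl]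

theorem smoothMax_le {p q r : ℝ} (hp : p ≤ r) (hq : q ≤ r) : smoothMax a p q ≤ r + a := by
  have := ramp_le ha (p - q)
  have : max (p - q) 0 ≤ r - q := max_le (by linarith) (by linarith)
  linarith [show smoothMax a p q = q + ramp a (p - q) from rfl]

/-- `ramp a` has slope between 0 and 1, so `smoothMax` is monotone in each argument; it also
commutes with adding a constant to both. -/
theorem smoothMax_le_smoothMax_add {p q p' q' c : ℝ} (hp : p ≤ p' + c) (hq : q ≤ q' + c) :
    smoothMax a p q ≤ smoothMax a p' q' + c := by
  have h1 : ramp a (p - q) ≤ ramp a (p' + c - q) := monotone_ramp ha (by linarith)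
  have h2 := monotone_sub_ramp ha (show p' - q' ≤ p' + c - q by linarith)
  simp only [smoothMax] at h2 ⊢
  linarith

theorem lipschitzWith_smoothMax {E : Type*} [PseudoMetricSpace E] {K : ℝ≥0} {f g : E → ℝ}
    (hf : LipschitzWith K f) (hg : LipschitzWith K g) :
    LipschitzWith K fun x => smoothMax a (f x) (g x) :=
  LipschitzWith.of_le_add_mul K fun x y =>
    smoothMax_le_smoothMax_add ha (hf.le_add_mul x y) (hg.le_add_mul x y)

end SmoothMax

theorem contDiffAt_smoothMax {E : Type*} [NormedAddCommGroup E] [NormedSpace ℝ E] (a : ℝ)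
    {f g : E → ℝ} {x : E} (hf : ContDiffAt ℝ 1 f x) (hg : ContDiffAt ℝ 1 g x) :
    ContDiffAt ℝ 1 (fun x => smoothMax a (f x) (g x)) x :=
  hg.add ((contDiff_ramp a).contDiffAt.comp x (hf.sub hg))

/-! ### Smoothing inside an open set with prescribed exterior values -/

section Boundary

variable {X : Type*} [NormedAddCommGroup X] [InnerProductSpace ℝ X] [CompleteSpace X]

/-- A Lipschitz function can be made `C¹` on an open set without changing it outside, at the price
of an arbitrarily small increase of its Lipschitz constant. -/
theorem LipschitzWith.exists_contDiffOn_eqOn_compl {K' η : ℝ≥0} (hη : 0 < η) {g : X → ℝ}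
    (hg : LipschitzWith K' g) {Ω : Set X} (hΩ : IsOpen Ω) (hne : Ωᶜ.Nonempty) :
    ∃ V : X → ℝ, ContDiffOn ℝ 1 V Ω ∧ LipschitzWith (K' + η) V ∧ Set.EqOn V g Ωᶜ := by
  set d : X → ℝ := fun x => Metric.infDist x Ωᶜ with hd
  have hd0 : ∀ x, 0 ≤ d x := fun x => Metric.infDist_nonneg
  have hη' : (0 : ℝ) < η := hη
  have he : ∀ n : ℕ, (0 : ℝ) < (1 / 4) ^ n := fun n => by positivity
  have hh : ∀ n : ℕ, (1 / 4 : ℝ) ^ n = (1 / 2) ^ n * (1 / 2) ^ n := fun n => by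
    rw [← mul_pow]; norm_num
  -- The slope `η 2⁻ⁿ` makes later profiles fall below earlier ones away from `Ωᶜ`, while the shift
  -- `4⁻ⁿ` vanishes faster and leaves room for the errors of smoothing.
  have hw : ∀ n : ℕ, ∃ w : X → ℝ, ContDiff ℝ 1 w ∧ LipschitzWith (K' + η) w ∧
      ∀ x, |w x - (g x + η * (1 / 2) ^ n * d x - (1 / 4) ^ n)| ≤ (1 / 4) ^ n / 8 := by
    intro n
    refine LipschitzWith.exists_contDiff_abs_sub_le (LipschitzWith.of_le_add_mul _ fun x y => ?_)
      (by have := he n; positivity)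
    have h1 := hg.le_add_mul x y
    have h2 : d x ≤ d y + dist x y := Metric.infDist_le_infDist_add_dist
    have h3 : (η : ℝ) * (1 / 2) ^ n ≤ η :=
      mul_le_of_le_one_right η.2 (pow_le_one₀ (by norm_num) (by norm_num))
    have h4 : (η : ℝ) * (1 / 2) ^ n * d x ≤ η * (1 / 2) ^ n * d y + η * dist x y := by
      calc (η : ℝ) * (1 / 2) ^ n * d x ≤ η * (1 / 2) ^ n * (d y + dist x y) := by gcongr
        _ ≤ _ := by rw [mul_add]; gcongr
    push_cast
    linarith
  choose w hwc hwl hwb using hw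
  let v : ℕ → X → ℝ := fun n => Nat.rec (w 0)
    (fun n f x => smoothMax ((1 / 4) ^ n / 16) (f x) (w (n + 1) x)) n
  have hv0 : v 0 = w 0 := rfl
  have hvs : ∀ n, v (n + 1) = fun x => smoothMax ((1 / 4) ^ n / 16) (v n x) (w (n + 1) x) :=
    fun n => rfl
  clear_value v
  have ha : ∀ n : ℕ, (0 : ℝ) < (1 / 4) ^ n / 16 := fun n => by have := he n; positivity
  have hvl : ∀ n, LipschitzWith (K' + η) (v n) := by
    intro n
    induction n with
    | zero => exact hv0 ▸ hwl 0
    | succ n ih => exact hvs n ▸ lipschitzWith_smoothMax (ha n) ih (hwl (n + 1))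
  have hvc : ∀ n x, ContDiffAt ℝ 1 (v n) x := by
    intro n
    induction n with
    | zero => exact fun x => hv0 ▸ (hwc 0).contDiffAt
    | succ n ih =>
      exact fun x => hvs n ▸ contDiffAt_smoothMax _ (ih x) (hwc (n + 1)).contDiffAt
  have hwv : ∀ n x, w n x ≤ v n x := by
    intro n x
    cases n with
    | zero => rw [hv0]
    | succ n => rw [hvs]; exact right_le_smoothMax (ha n) _ _
  have hlow : ∀ n x, g x - 2 * (1 / 4) ^ n ≤ v n x := by
    intro n x
    have h1 := (abs_le.1 (hwb n x)).1
    have h2 : 0 ≤ (η : ℝ) * (1 / 2) ^ n * d x := by have := hd0 x; positivity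
    linarith [hwv n x, he n]
  have hwup : ∀ n x, w n x ≤ g x + η * d x - 7 / 8 * (1 / 4) ^ n := by
    intro n x
    have h1 := (abs_le.1 (hwb n x)).2
    have h2 : (η : ℝ) * (1 / 2) ^ n * d x ≤ η * d x :=
      mul_le_mul_of_nonneg_right
        (mul_le_of_le_one_right η.2 (pow_le_one₀ (by norm_num) (by norm_num))) (hd0 x)
    linarith
  have hup : ∀ n x, v n x ≤ g x + η * d x - 1 / 2 * (1 / 4) ^ n := by
    intro n x
    induction n with
    | zero => rw [hv0]; linarith [hwup 0 x, he 0]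
    | succ n ih =>
      have h1 := hwup (n + 1) x
      rw [hvs]
      rw [pow_succ] at h1 ⊢
      refine (smoothMax_le (ha n) (r := g x + η * d x - 7 / 32 * (1 / 4) ^ n) ?_ ?_).trans ?_ <;>
        linarith [he n]
  -- Once `2⁻ⁿ ≤ η d x / 3`, the gain in slope beats the shifts, so `w (n + 1)` lies below `v n` by
  -- more than the smoothing width.
  have hstep : ∀ s, 0 < s → ∃ N : ℕ, ∀ n ≥ N, ∀ x, s ≤ d x → v (n + 1) x = v n x := by
    intro s hs
    obtain ⟨N, hN⟩ := exists_pow_lt_of_lt_one (show 0 < η * s / 3 by positivity)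
      (by norm_num : (1 / 2 : ℝ) < 1)
    refine ⟨N, fun n hn x hx => ?_⟩
    rw [hvs]
    refine smoothMax_of_add_le (ha n) ?_
    have h1 := (abs_le.1 (hwb (n + 1) x)).2
    have h2 := (abs_le.1 (hwb n x)).1
    have h3 : (1 / 2 : ℝ) ^ n ≤ η * d x / 3 := by
      refine (pow_le_pow_of_le_one (by norm_num) (by norm_num) hn).trans (hN.le.trans ?_)
      gcongr
    have h4 : (1 / 4 : ℝ) ^ n ≤ η * d x / 3 * (1 / 2) ^ n := by rw [hh]; gcongr
    rw [pow_succ, pow_succ] at h1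
    linarith [hwv n x, he n]
  have hconst : ∀ s, 0 < s → ∃ N : ℕ, ∀ n ≥ N, ∀ x, s ≤ d x → v n x = v N x := by
    intro s hs
    obtain ⟨N, hN⟩ := hstep s hs
    refine ⟨N, fun n hn x hx => ?_⟩
    induction n, hn using Nat.le_induction with
    | base => rfl
    | succ n hn ih => rw [hN n hn x hx, ih]
  have hdpos : ∀ x ∈ Ω, 0 < d x := fun x hx =>
    (hΩ.isClosed_compl.notMem_iff_infDist_pos hne).1 (by simpa using hx)
  have hlim : ∀ x, ∃ l, Tendsto (fun n => v n x) atTop (𝓝 l) ∧ (x ∉ Ω → l = g x) := by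
    intro x
    by_cases hx : x ∈ Ω
    · obtain ⟨N, hN⟩ := hconst (d x) (hdpos x hx)
      exact ⟨v N x, tendsto_atTop_of_eventually_const (i₀ := N) fun n hn => hN n hn x le_rfl,
        fun h => absurd hx h⟩
    · have hdx : d x = 0 := Metric.infDist_zero_of_mem hx
      have h0 : Tendsto (fun n : ℕ => (1 / 4 : ℝ) ^ n) atTop (𝓝 0) :=
        tendsto_pow_atTop_nhds_zero_of_lt_one (by norm_num) (by norm_num)
      refine ⟨g x, tendsto_of_tendsto_of_tendsto_of_le_of_le
        (g := fun n => g x - 2 * (1 / 4) ^ n) (h := fun _ => g x) ?_ tendsto_const_nhds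
        (fun n => hlow n x) (fun n => ?_), fun _ => rfl⟩
      · simpa using (h0.const_mul 2).const_sub (g x)
      · have := hup n x
        rw [hdx] at this
        show v n x ≤ g x
        linarith [he n]
  choose V hV hVg using hlim
  refine ⟨V, fun x hx => ?_, LipschitzWith.of_dist_le_mul fun x y => ?_, fun x hx => hVg x hx⟩
  · obtain ⟨N, hN⟩ := hconst (d x / 2) (half_pos (hdpos x hx))
    refine ((hvc N x).congr_of_eventuallyEq ?_).contDiffWithinAt
    have : ∀ᶠ y in 𝓝 x, d x / 2 < d y :=
      (Metric.continuous_infDist_pt Ωᶜ).continuousAt.eventually_const_lt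
        (half_lt_self (hdpos x hx))
    filter_upwards [this] with y hy
    exact tendsto_nhds_unique (hV y)
      (tendsto_atTop_of_eventually_const (i₀ := N) fun n hn => hN n hn y hy.le)
  · exact le_of_tendsto ((hV x).dist (hV y))
      (Eventually.of_forall fun n => (hvl n).dist_le_mul x y)

/-- Smoothing of `u` on `Ω` which agrees outside `Ω` with a function `g` having a smaller Lipschitz
constant than `u`. -/
theorem LipschitzWith.exists_contDiffOn_abs_sub_le {K' K : ℝ≥0} (hK : K' < K) {u g : X → ℝ}
    (hu : LipschitzWith K u) (hg : LipschitzWith K' g) {Ω : Set X} (hΩ : IsOpen Ω) {ε : ℝ}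
    (hε : 0 < ε) :
    ∃ v : X → ℝ, ContDiffOn ℝ 1 v Ω ∧ LipschitzWith K v ∧ (∀ x, |u x - v x| ≤ ε) ∧
      ∀ x ∉ Ω, u x = g x → v x = g x := by
  obtain ⟨U, hUc, hUl, hUb⟩ := hu.exists_contDiff_abs_sub_le (show 0 < ε / 4 by positivity)
  -- For empty `Ωᶜ` the function `infDist` is identically 0, but `U` itself then suffices.
  rcases Set.eq_empty_or_nonempty Ωᶜ with hΩc | hne
  · refine ⟨U, hUc.contDiffOn, hUl, fun x => ?_, fun x hx => ?_⟩
    · rw [abs_sub_comm]; linarith [hUb x]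
    · exact absurd (Set.mem_compl hx) (hΩc ▸ Set.notMem_empty x)
  obtain ⟨V, hVc, hVl, hVg⟩ := hg.exists_contDiffOn_eqOn_compl (tsub_pos_of_lt hK) hΩ hne
  rw [add_tsub_cancel_of_le hK.le] at hVl
  set a := ε / 4 with ha'
  have ha : 0 < a := by positivity
  -- `v` is a smooth version of the median of `V`, `U - 2 * a` and `U + 2 * a`
  have hs : ∀ {f : X → ℝ} (c : ℝ), LipschitzWith K f → LipschitzWith K fun x => f x + c :=
    fun c hf => LipschitzWith.of_le_add_mul K fun x y => by linarith [hf.le_add_mul x y]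
  refine ⟨fun x => smoothMax a (-smoothMax a (-V x) (-U x + -(2 * a))) (U x + -(2 * a)),
    fun x hx => ?_, ?_, fun x => ?_, fun x hx hux => ?_⟩
  · have hV := hVc.contDiffAt (hΩ.mem_nhds hx)
    have hU : ContDiffAt ℝ 1 U x := hUc.contDiffAt
    exact (contDiffAt_smoothMax a
      (contDiffAt_smoothMax a hV.neg (hU.neg.add contDiffAt_const)).neg
      (hU.add contDiffAt_const)).contDiffWithinAt
  · exact lipschitzWith_smoothMax ha
      (lipschitzWith_smoothMax ha hVl.neg (hs _ hUl.neg)).neg (hs _ hUl)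
  -- The result lies in `[U - 2a, U + 3a]`; with `|U - u| ≤ a` the total error is `4a = ε`.
  · have h1 := right_le_smoothMax ha (-V x) (-U x + -(2 * a))
    have h2 := right_le_smoothMax ha (-smoothMax a (-V x) (-U x + -(2 * a))) (U x + -(2 * a))
    have h3 := smoothMax_le ha (p := -smoothMax a (-V x) (-U x + -(2 * a)))
      (q := U x + -(2 * a)) (r := U x + 2 * a) (by linarith) (by linarith)
    have h4 := abs_le.1 (hUb x)
    rw [abs_le]
    constructor <;> linarith
  -- Here `|U - V| ≤ a`, so both barriers `U ± 2a` are at least `a` away from `V` and the smoothed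
  -- median is exact.
  · have h4 := abs_le.1 (hUb x)
    have hVx : V x = g x := hVg hx
    have h5 : smoothMax a (-V x) (-U x + -(2 * a)) = -V x :=
      smoothMax_of_add_le ha (by linarith)
    simp only [h5, neg_neg]
    rw [smoothMax_of_add_le ha (by linarith), hVx]

end Boundary

/-! ### The constant `lip` and Lipschitz extension -/

section LipConstant

variable {E : Type*} [MetricSpace E] {f : E → ℝ} {S : Set E}

theorem lip_nonneg (f : E → ℝ) (S : Set E) : 0 ≤ lip f S :=
  Real.sInf_nonneg fun _ hL => hL.1.le

theorem lip_le {L : ℝ} (hL : 0 < L) (h : ∀ x ∈ S, ∀ y ∈ S, |f x - f y| ≤ L * dist x y) :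
    lip f S ≤ L :=
  csInf_le ⟨0, fun _ hL => hL.1.le⟩ ⟨hL, h⟩

theorem IsLipschitzOn.abs_sub_le (hf : IsLipschitzOn f S) {x y : E} (hx : x ∈ S) (hy : y ∈ S) :
    |f x - f y| ≤ lip f S * dist x y := by
  obtain ⟨L, hL, hLf⟩ := hf
  have hne : {L : ℝ | 0 < L ∧ ∀ x ∈ S, ∀ y ∈ S, |f x - f y| ≤ L * dist x y}.Nonempty :=
    ⟨L + 1, by positivity, fun x hx y hy => (hLf x hx y hy).trans (by gcongr; linarith)⟩
  rcases (dist_nonneg (x := x) (y := y)).eq_or_lt with h | h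
  · rw [dist_eq_zero.1 h.symm]; simp
  · rw [← div_le_iff₀ h]
    exact le_csInf hne fun M hM => (div_le_iff₀ h).2 (hM.2 x hx y hy)

theorem IsLipschitzOn.mono {T : Set E} (hf : IsLipschitzOn f T) (hST : S ⊆ T) :
    IsLipschitzOn f S :=
  let ⟨L, hL, h⟩ := hf
  ⟨L, hL, fun x hx y hy => h x (hST hx) y (hST hy)⟩

theorem IsLipschitzOn.exists_extension (hf : IsLipschitzOn f S) {L : ℝ≥0} (hL : lip f S ≤ L) :
    ∃ g : E → ℝ, LipschitzWith L g ∧ Set.EqOn f g S :=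
  LipschitzOnWith.extend_real <| LipschitzOnWith.of_dist_le_mul fun x hx y hy =>
    (hf.abs_sub_le hx hy).trans (by gcongr)

end LipConstant

theorem theorem1p2 {X : Type*} [NormedAddCommGroup X] [InnerProductSpace ℝ X] [CompleteSpace X]
    (Ω : Set X) (hΩ : IsOpen Ω) (u₀ : X → ℝ) (hu₀ : IsLipschitzOn u₀ (closure Ω))
    (hlip : lip u₀ (frontier Ω) < lip u₀ (closure Ω)) (ε : ℝ) (hε : 0 < ε) :
    ∃ v : X → ℝ,
      ContDiffOn ℝ 1 v Ω ∧
      IsLipschitzOn v (closure Ω) ∧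
      lip v (closure Ω) ≤ lip u₀ (closure Ω) ∧
      (∀ x ∈ frontier Ω, v x = u₀ x) ∧
      (∀ x ∈ closure Ω, |u₀ x - v x| ≤ ε) := by
  let K : ℝ≥0 := ⟨lip u₀ (closure Ω), lip_nonneg _ _⟩
  let K' : ℝ≥0 := ⟨lip u₀ (frontier Ω), lip_nonneg _ _⟩
  obtain ⟨u, hu, huu₀⟩ := hu₀.exists_extension (L := K) le_rfl
  obtain ⟨g, hg, hgu₀⟩ := (hu₀.mono frontier_subset_closure).exists_extension (L := K') le_rfl
  obtain ⟨v, hvc, hvl, hvu, hvg⟩ :=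
    hu.exists_contDiffOn_abs_sub_le (show K' < K from hlip) hg hΩ hε
  have hv : ∀ x ∈ closure Ω, ∀ y ∈ closure Ω,
      |v x - v y| ≤ lip u₀ (closure Ω) * dist x y := fun x _ y _ => hvl.dist_le_mul x y
  -- The strict inequality also makes `lip u₀ (closure Ω)` positive, hence admissible in the infimum
  -- defining `lip`.
  refine ⟨v, hvc, ⟨_, lip_nonneg _ _, hv⟩, lip_le ((lip_nonneg _ _).trans_lt hlip) hv,
    fun x hx => ?_, fun x hx => ?_⟩
  · rw [hgu₀ hx]
    refine hvg x (by rw [hΩ.frontier_eq] at hx; exact hx.2) ?_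
    rw [← hgu₀ hx, huu₀ (frontier_subset_closure hx)]
  · rw [huu₀ hx]
    exact hvu x
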